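/- Let $\Sigma_0$ be a countably infinite set of constants. A fresh-variable automaton (FVA) $A$ whose actions are constants or variables consists of a finite set $Q(A)$ of states with an initial state, a finite set $\mathrm{var}(A)$ of variables, a finite set of transitions $p\xrightarrow{!\alpha}p'$ or $p\xrightarrow{?\alpha}p'$ with $\alpha\in\Sigma_0\cup\mathrm{var}(A)$, a set of accepting states (not used here), and a refreshing function $\kappa$ assigning to each variable $x$ the set $\kappa(x)$ of states in which $x$ is refreshed. $\Sigma_0(A)$ is the finite set of constants occurring in the transitions of $A$. The variables of two FVAs $A$ and $B$ are taken to be disjoint. The simulation game $\mathcal G(A,B)$ is played by Abelard and Eloise. A position records the current states of $A$ and $B$ and two ground substitutions $M,N$ instantiating some of the variables of $A$ and of $B$; at the start both automata are in their initial states and no variable is instantiated. In each round Abelard takes a transition $p\xrightarrow{!\alpha}p'$ or $p\xrightarrow{?\alpha}p'$ of $A$ from the current state $p$ of $A$, and Eloise answers with a transition of $B$ of the opposite polarity from the current state $q$ of $B$. * If Abelard plays $!\alpha$ and $M(\alpha)$ is a free variable, he instantiates it by a constant of his choice. Eloise answers the resulting $!a$ by some $q\xrightarrow{?\beta}q'$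 such that $N(\beta)$ matches $a$, i.e. $N(\beta)$ is the constant $a$, or is a free variable, which then receives the value $a$. * If Abelard plays $?\alpha$, Eloise takes some $q\xrightarrow{!\beta}q'$; if $N(\beta)$ is a free variable, she instantiates it by a constant of her choice. $M(\alpha)$ has to match the resulting constant $b$ (a free variable $M(\alpha)$ receives the value $b$). After the round $A$ is in $p'$ and $B$ in $q'$, and the variables refreshed in $p'$, respectively in $q'$, become free again. A player who has to move and cannot loses; infinite plays are won by Eloise. The constants present in a position are the values of $M$ and $N$ and, when Eloise has to answer $!a$, also $a$. For a set $C\subseteq\Sigma_0$ let $\mathcal G_C(A,B)$ be the game played like $\mathcal G(A,B)$, except that both players, when they instantiate a variable by a constant of their choice, must choose it in $C$. **Proposition.** There is a family of pairwise distinct constants of $\Sigma_0\setminus(\Sigma_0(A)\cup\Sigma_0(B))$ indexed by the disjoint union of $\mathrm{var}(A)\times\mathrm{var}(B)$ and $\mathrm{var}(B)\times\mathrm{var}(A)$. For every such family, let $C_0$ consist of $\Sigma_0(A)\cup\Sigma_0(B)$ and the constants of the family. Then $C_0$ is finite, and: 1. Eloise has a winning strategy in $\mathcal G(A,B)$ iff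 she has a winning strategy $s$ in $\mathcal G(A,B)$ such that, in every play of $\mathcal G(A,B)$ that follows $s$, she instantiates variables only by constants that are in $C_0$ or present in the current position, and such that $s$ is also a winning strategy in $\mathcal G_{C_0}(A,B)$ (so as long as Abelard chooses constants in $C_0$, Eloise instantiates variables by constants of $C_0$ only). 2. If $\mathrm{var}(B)\neq\emptyset$ or $\mathrm{var}(A)=\emptyset$, then Eloise has a winning strategy in $\mathcal G(A,B)$ iff she has one in $\mathcal G_{C_0}(A,B)$. -/

import Mathlib

/-- The two kinds of communication: `!` (send) and `?` (receive). -/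
inductive Polarity where
  | send
  | recv

/-- The contents of an action: a constant of `K` or a variable of `V`. -/
inductive Letter (K V : Type*) where
  | const (a : K)
  | var (x : V)

/-- A fresh-variable automaton with constants in `K`, variables `V` and states `Q`, all of whose
actions are of the form `!α` or `?α` with `α` a constant or a variable. -/
structure FVA (K V Q : Type*) where
  /-- the initial state -/
  init : Q
  /-- the finitely many transitions `(p, !/?, α, p')` -/
  trans : Finset (Q × Polarity × Letter K V × Q)
  /-- the accepting states (they play no role in the simulation game) -/
  accept : Set Q
  /-- the refreshing function: `κ x` is the set of states in which `x` is refreshed -/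
  κ : V → Set Q

/-- The constants that occur in the actions of an automaton. -/
def FVA.consts {K V Q : Type*} (A : FVA K V Q) : Set K :=
  {a | ∃ p d p', (p, d, Letter.const a, p') ∈ A.trans}

/-- A ground substitution with a partial domain: `M x = some a` says that `x` is currently
instantiated by `a`, and `M x = none` that `x` is free. -/
abbrev Store (K V : Type*) := V → Option K

/-- The values of a ground substitution. -/
def Store.values {K V : Type*} (M : Store K V) : Set K := {a | ∃ x, M x = some a}

/-- `Ground D M α a M'`: under the substitution `M`, the letter `α` becomes the constant `a`, after
`α` has been instantiated, if it is a free variable, by a constant in `D`; the resulting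
substitution is `M'`. With `D = Set.univ` this says that `M'` extends `M` by the solution of the
problem of matching `M α` to the constant `a`. -/
inductive Ground {K V : Type*} (D : Set K) (M : Store K V) : Letter K V → K → Store K V → Prop where
  | const (a : K) : Ground D M (Letter.const a) a M
  | bound (x : V) (a : K) (h : M x = some a) : Ground D M (Letter.var x) a M
  | free (x : V) (a : K) (M' : Store K V) (h : M x = none) (ha : a ∈ D)
      (hx : M' x = some a) (hM' : ∀ y, y ≠ x → M' y = M y) : Ground D M (Letter.var x) a M'

open Classical in
/-- On entering the state `q` the variables that are refreshed in `q` become free. -/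
noncomputable def FVA.refresh {K V Q : Type*} (A : FVA K V Q) (q : Q) (M : Store K V) :
    Store K V :=
  fun x => if q ∈ A.κ x then none else M x

/-- Positions of the simulation game. `M` and `N` are the current substitutions of `A` and `B`. -/
inductive Pos (K VA VB QA QB : Type*) where
  /-- Abelard is to move, `A` is in state `p` and `B` in state `q` -/
  | abelard (p : QA) (M : Store K VA) (q : QB) (N : Store K VB)
  /-- Eloise has to answer the action `!a`, by which `A` moves to `p` -/
  | afterSend (a : K) (p : QA) (M : Store K VA) (q : QB) (N : Store K VB)
  /-- Eloise has to answer the action `?α` (to be read under `M`), by which `A` moves to `p` -/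
  | afterRecv (α : Letter K VA) (p : QA) (M : Store K VA) (q : QB) (N : Store K VB)

section Game

variable {K VA VB QA QB : Type*}

/-- The positions in which Eloise is to move. -/
def Pos.IsEloise : Pos K VA VB QA QB → Prop
  | .abelard _ _ _ _ => False
  | .afterSend _ _ _ _ _ => True
  | .afterRecv _ _ _ _ _ => True

/-- The constants that are present in a position as values of variables or as the constant that has
just been sent. -/
def Pos.consts : Pos K VA VB QA QB → Set K
  | .abelard _ M _ N => M.values ∪ N.values
  | .afterSend a _ M _ N => {a} ∪ M.values ∪ N.values
  | .afterRecv _ _ M _ N => M.values ∪ N.values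

/-- Abelard's moves: he takes a transition of `A`. If it is labelled `!x` with `x` free, he
instantiates `x` by a constant of `D`. -/
inductive AbelardMove (A : FVA K VA QA) (D : Set K) :
    Pos K VA VB QA QB → Pos K VA VB QA QB → Prop where
  | send (p p' : QA) (M M' : Store K VA) (q : QB) (N : Store K VB) (α : Letter K VA) (a : K)
      (ht : (p, Polarity.send, α, p') ∈ A.trans) (hα : Ground D M α a M') :
      AbelardMove A D (.abelard p M q N) (.afterSend a p' M' q N)
  | recv (p p' : QA) (M : Store K VA) (q : QB) (N : Store K VB) (α : Letter K VA)
      (ht : (p, Polarity.recv, α, p') ∈ A.trans) :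
      AbelardMove A D (.abelard p M q N) (.afterRecv α p' M q N)

/-- Eloise's moves. She answers `!a` by a transition `?β` of `B` such that `β` matches `a`. She
answers `?α` by a transition `!β` of `B`; if `β` is a free variable, she instantiates it by a
constant of `D`, and `α` has to match the constant that is sent. -/
inductive EloiseMove (A : FVA K VA QA) (B : FVA K VB QB) (D : Set K) :
    Pos K VA VB QA QB → Pos K VA VB QA QB → Prop where
  | recv (a : K) (p : QA) (M : Store K VA) (q q' : QB) (N N' : Store K VB) (β : Letter K VB)
      (ht : (q, Polarity.recv, β, q') ∈ B.trans) (hβ : Ground Set.univ N β a N') :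
      EloiseMove A B D (.afterSend a p M q N) (.abelard p (A.refresh p M) q' (B.refresh q' N'))
  | send (α : Letter K VA) (p : QA) (M M' : Store K VA) (q q' : QB) (N N' : Store K VB)
      (β : Letter K VB) (b : K)
      (ht : (q, Polarity.send, β, q') ∈ B.trans) (hβ : Ground D N β b N')
      (hα : Ground Set.univ M α b M') :
      EloiseMove A B D (.afterRecv α p M q N) (.abelard p (A.refresh p M') q' (B.refresh q' N'))

/-- The starting position: both automata are in their initial states, all variables are free. -/
def startPos (A : FVA K VA QA) (B : FVA K VB QB) : Pos K VA VB QA QB :=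
  .abelard A.init (fun _ => none) B.init (fun _ => none)

/-- A strategy of Eloise maps a history of positions (the latest one first) to the next position. -/
abbrev Strategy (K VA VB QA QB : Type*) := List (Pos K VA VB QA QB) → Pos K VA VB QA QB

/-- `History A B D s h`: in the game in which both players instantiate variables by constants of `D`
only, `h` is the list of the positions, the latest one first, of a finite partial play in which
Eloise follows `s`. -/
inductive History (A : FVA K VA QA) (B : FVA K VB QB) (D : Set K) (s : Strategy K VA VB QA QB) :
    List (Pos K VA VB QA QB) → Prop where
  | start : History A B D s [startPos A B]
  | abelard (P P' : Pos K VA VB QA QB) (h : List (Pos K VA VB QA QB))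
      (hh : History A B D s (P :: h)) (hm : AbelardMove A D P P') :
      History A B D s (P' :: P :: h)
  | eloise (P : Pos K VA VB QA QB) (h : List (Pos K VA VB QA QB))
      (hh : History A B D s (P :: h)) (hm : EloiseMove A B D P (s (P :: h))) :
      History A B D s (s (P :: h) :: P :: h)

/-- The strategy `s` is winning for Eloise in the game in which both players instantiate variables
by constants of `D` only. A player who has to move and cannot loses, and infinite plays are won by
Eloise; so `s` is winning iff it gives a legal move whenever a play that follows `s` has arrived at
a position of Eloise. -/
def IsWinning (A : FVA K VA QA) (B : FVA K VB QB) (D : Set K) (s : Strategy K VA VB QA QB) : Prop :=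
  ∀ P h, History A B D s (P :: h) → P.IsEloise → EloiseMove A B D P (s (P :: h))

/-- In every play of the unrestricted game that follows `s`, Eloise instantiates variables only by
constants that belong to `C` or are present in the current position. -/
def InstantiatesFrom (A : FVA K VA QA) (B : FVA K VB QB) (C : Set K)
    (s : Strategy K VA VB QA QB) : Prop :=
  ∀ P h, History A B Set.univ s (P :: h) → P.IsEloise → EloiseMove A B (C ∪ P.consts) P (s (P :: h))

/-- `c` is a family of pairwise distinct constants, one for each pair of a variable of `A` and a
variable of `B` in either order, none of which occurs in `A` or `B`. -/
def IsFreshFamily (A : FVA K VA QA) (B : FVA K VB QB) (c : (VA × VB) ⊕ (VB × VA) → K) : Prop :=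
  Function.Injective c ∧ ∀ i, c i ∉ A.consts ∪ B.consts

/-- The constants of `A` and of `B` together with the fresh constants of the family `c`. -/
def constPool (A : FVA K VA QA) (B : FVA K VB QB) (c : (VA × VB) ⊕ (VB × VA) → K) : Set K :=
  A.consts ∪ B.consts ∪ Set.range c

end Game

/-! The rules only compare constants, so the unrestricted game is invariant under every permutation
of the constants that fixes those occurring in the two automata (`AbelardMove.rename`,
`EloiseMove.rename`). A player who picks a constant outside the pool that is not present might as
well pick an unused member of the family: swapping the two changes nothing in the current position.

An unused member exists by counting. At such a choice some variable of `A` is free, so at most `m +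
n - 1` values are present, where `m` and `n` count the variables of `A` and `B`, whereas the family
has `2mn ≥ m + n` members once `m, n ≥ 1` (`exists_notMem_values`). When Eloise chooses, both counts
are positive, since her new constant passes from a free variable of `B` to one of `A`. When Abelard
chooses, only `m ≥ 1` is automatic; hence the extra hypothesis of the second claim.

Strategies are transferred by keeping the actual position equal, up to a permutation, to one reached
by the given strategy, and correcting the permutation after each choice. -/

/-! ### Renaming the constants of a position -/

/-- Rename the constants of a letter. -/
def Letter.rename {K V : Type*} (τ : Equiv.Perm K) : Letter K V → Letter K V
  | .const a => .const (τ a)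
  | .var x => .var x

/-- Rename the values of a ground substitution. -/
def Store.rename {K V : Type*} (τ : Equiv.Perm K) (M : Store K V) : Store K V :=
  fun x => (M x).map τ

/-- Rename the constants of a position. -/
def Pos.rename {K VA VB QA QB : Type*} (τ : Equiv.Perm K) :
    Pos K VA VB QA QB → Pos K VA VB QA QB
  | .abelard p M q N => .abelard p (M.rename τ) q (N.rename τ)
  | .afterSend a p M q N => .afterSend (τ a) p (M.rename τ) q (N.rename τ)
  | .afterRecv α p M q N => .afterRecv (α.rename τ) p (M.rename τ) q (N.rename τ)

section Rename

variable {K V Q VA VB QA QB : Type*}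

theorem Letter.rename_one (α : Letter K V) : α.rename 1 = α := by
  cases α <;> rfl

theorem Letter.rename_mul (σ τ : Equiv.Perm K) (α : Letter K V) :
    α.rename (σ * τ) = (α.rename τ).rename σ := by
  cases α <;> rfl

theorem Store.rename_one (M : Store K V) : M.rename 1 = M := by
  funext x
  simp [Store.rename]

theorem Store.rename_mul (σ τ : Equiv.Perm K) (M : Store K V) :
    M.rename (σ * τ) = (M.rename τ).rename σ := by
  funext x
  simp [Store.rename]

theorem Store.rename_eq_self {σ : Equiv.Perm K} {M : Store K V}
    (h : ∀ a ∈ M.values, σ a = a) : M.rename σ = M := by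
  funext x
  cases hx : M x with
  | none => simp [Store.rename, hx]
  | some a => simp [Store.rename, hx, h a ⟨x, hx⟩]

theorem Pos.rename_one (P : Pos K VA VB QA QB) : P.rename 1 = P := by
  cases P <;> simp [Pos.rename, Store.rename_one, Letter.rename_one]

theorem Pos.rename_mul (σ τ : Equiv.Perm K) (P : Pos K VA VB QA QB) :
    P.rename (σ * τ) = (P.rename τ).rename σ := by
  cases P <;> simp [Pos.rename, Store.rename_mul, Letter.rename_mul]

theorem Pos.isEloise_rename (τ : Equiv.Perm K) (P : Pos K VA VB QA QB) :
    (P.rename τ).IsEloise ↔ P.IsEloise := by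
  cases P <;> rfl

theorem FVA.rename_refresh (A : FVA K V Q) (q : Q) (τ : Equiv.Perm K) (M : Store K V) :
    Store.rename τ (A.refresh q M) = A.refresh q (M.rename τ) := by
  funext x
  by_cases h : q ∈ A.κ x <;> simp [Store.rename, FVA.refresh, h]

theorem FVA.rename_letter {A : FVA K V Q} {τ : Equiv.Perm K} (hτ : ∀ a ∈ A.consts, τ a = a)
    {p p' : Q} {d : Polarity} {α : Letter K V} (ht : (p, d, α, p') ∈ A.trans) :
    α.rename τ = α := by
  cases α with
  | const a => exact congrArg Letter.const (hτ a ⟨p, d, p', ht⟩)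
  | var x => rfl

theorem Ground.rename (τ : Equiv.Perm K) {M M' : Store K V} {α : Letter K V} {a : K}
    (h : Ground Set.univ M α a M') :
    Ground Set.univ (M.rename τ) (α.rename τ) (τ a) (M'.rename τ) := by
  cases h with
  | const => exact .const _
  | bound x _ h => exact .bound x _ (by simp [Store.rename, h])
  | free x _ _ h _ hx hM' =>
    exact .free x _ _ (by simp [Store.rename, h]) trivial (by simp [Store.rename, hx])
      fun y hy => by simp [Store.rename, hM' y hy]

theorem Ground.of_mem {D D' : Set K} {M M' : Store K V} {α : Letter K V} {a : K}
    (h : Ground D M α a M') (ha : a ∈ D') : Ground D' M α a M' := by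
  cases h with
  | const => exact .const _
  | bound x _ h => exact .bound x _ h
  | free x _ _ h _ hx hM' => exact .free x _ _ h ha hx hM'

theorem Ground.mono {D D' : Set K} (hD : D ⊆ D') {M M' : Store K V} {α : Letter K V} {a : K}
    (h : Ground D M α a M') : Ground D' M α a M' := by
  cases h with
  | const => exact .const _
  | bound x _ h => exact .bound x _ h
  | free x _ _ h ha hx hM' => exact .free x _ _ h (hD ha) hx hM'

/-- A letter that becomes a constant that is neither its own name nor a value of the substitution
is a free variable. -/
theorem Ground.exists_free {D : Set K} {M M' : Store K V} {α : Letter K V} {a : K}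
    (h : Ground D M α a M') (hα : α ≠ .const a) (ha : a ∉ M.values) : ∃ x, M x = none := by
  cases h with
  | const => exact absurd rfl hα
  | bound x _ h => exact absurd ⟨x, h⟩ ha
  | free x _ _ h _ hx hM' => exact ⟨x, h⟩

theorem Ground.values_subset {D : Set K} {M M' : Store K V} {α : Letter K V} {a : K}
    (h : Ground D M α a M') : M'.values ⊆ insert a M.values := by
  cases h with
  | const => exact Set.subset_insert _ _
  | bound x _ h => exact Set.subset_insert _ _
  | free x _ _ h _ hx hM' =>
    rintro b ⟨y, hy⟩
    by_cases hyx : y = x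
    · subst hyx
      exact Or.inl (Option.some.inj (hy.symm.trans hx))
    · exact Or.inr ⟨y, (hM' y hyx).symm.trans hy⟩

/-- In a pool that contains the constants of the automaton and the values of the substitution, the
letters of the automaton become constants of the pool. -/
theorem Ground.mem {A : FVA K V Q} {D : Set K} (hA : A.consts ⊆ D) {M M' : Store K V}
    (hM : M.values ⊆ D) {α : Letter K V} {a : K} (h : Ground D M α a M') {p p' : Q} {d : Polarity}
    (ht : (p, d, α, p') ∈ A.trans) : a ∈ D := by
  cases h with
  | const => exact hA ⟨p, d, p', ht⟩
  | bound x _ h => exact hM ⟨x, h⟩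
  | free x _ _ h ha hx hM' => exact ha

theorem FVA.values_refresh_subset (A : FVA K V Q) (q : Q) (M : Store K V) :
    Store.values (A.refresh q M) ⊆ M.values := by
  rintro a ⟨x, hx⟩
  by_cases h : q ∈ A.κ x
  · simp [FVA.refresh, h] at hx
  · exact ⟨x, by simpa [FVA.refresh, h] using hx⟩

end Rename

/-! ### Moves: invariance under renaming, and the constants they introduce -/

section Moves

variable {K VA VB QA QB : Type*} {A : FVA K VA QA} {B : FVA K VB QB}

theorem AbelardMove.mono {D D' : Set K} (hD : D ⊆ D') {P P' : Pos K VA VB QA QB}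
    (h : AbelardMove A D P P') : AbelardMove A D' P P' := by
  cases h with
  | send p p' M M' q N α a ht hα => exact .send _ _ _ _ _ _ _ _ ht (hα.mono hD)
  | recv p p' M q N α ht => exact .recv _ _ _ _ _ _ ht

theorem EloiseMove.mono {D D' : Set K} (hD : D ⊆ D') {P P' : Pos K VA VB QA QB}
    (h : EloiseMove A B D P P') : EloiseMove A B D' P P' := by
  cases h with
  | recv a p M q q' N N' β ht hβ => exact .recv _ _ _ _ _ _ _ _ ht hβ
  | send α p M M' q q' N N' β b ht hβ hα => exact .send _ _ _ _ _ _ _ _ _ _ ht (hβ.mono hD) hα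

theorem EloiseMove.isEloise {D : Set K} {P P' : Pos K VA VB QA QB}
    (h : EloiseMove A B D P P') : P.IsEloise := by
  cases h <;> trivial

theorem AbelardMove.rename {τ : Equiv.Perm K} (hτ : ∀ a ∈ A.consts, τ a = a)
    {P P' : Pos K VA VB QA QB} (h : AbelardMove A Set.univ P P') :
    AbelardMove A Set.univ (P.rename τ) (P'.rename τ) := by
  cases h with
  | send p p' M M' q N α a ht hα =>
    exact .send _ _ _ _ _ _ α _ ht (FVA.rename_letter hτ ht ▸ hα.rename τ)
  | recv p p' M q N α ht =>
    simp only [Pos.rename, FVA.rename_letter hτ ht]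
    exact .recv _ _ _ _ _ _ ht

/-- Fixing the constants of `B` is enough: the action of `A` being answered is part of the position
and is renamed with it. -/
theorem EloiseMove.rename {τ : Equiv.Perm K} (hτ : ∀ a ∈ B.consts, τ a = a)
    {P P' : Pos K VA VB QA QB} (h : EloiseMove A B Set.univ P P') :
    EloiseMove A B Set.univ (P.rename τ) (P'.rename τ) := by
  cases h with
  | recv a p M q q' N N' β ht hβ =>
    simp only [Pos.rename, FVA.rename_refresh]
    exact .recv _ _ _ _ _ _ _ β ht (FVA.rename_letter hτ ht ▸ hβ.rename τ)
  | send α p M M' q q' N N' β b ht hβ hα =>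
    simp only [Pos.rename, FVA.rename_refresh]
    exact .send _ _ _ _ _ _ _ _ β _ ht (FVA.rename_letter hτ ht ▸ hβ.rename τ) (hα.rename τ)

theorem AbelardMove.consts_subset {D : Set K} (hA : A.consts ⊆ D) {P P' : Pos K VA VB QA QB}
    (h : AbelardMove A D P P') (hP : P.consts ⊆ D) : P'.consts ⊆ D := by
  cases h with
  | send p p' M M' q N α a ht hα =>
    obtain ⟨hM, hN⟩ := Set.union_subset_iff.1 hP
    have ha := hα.mem hA hM ht
    exact Set.union_subset (Set.union_subset (Set.singleton_subset_iff.2 ha)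
      (hα.values_subset.trans (Set.insert_subset ha hM))) hN
  | recv p p' M q N α ht => exact hP

/-- The matchings over `Set.univ` bring in nothing new: the constant received is either `a`, already
present, or `b`, produced by `B` within `D`. -/
theorem EloiseMove.consts_subset {D : Set K} (hB : B.consts ⊆ D) {P P' : Pos K VA VB QA QB}
    (h : EloiseMove A B D P P') (hP : P.consts ⊆ D) : P'.consts ⊆ D := by
  cases h with
  | recv a p M q q' N N' β ht hβ =>
    obtain ⟨haM, hN⟩ := Set.union_subset_iff.1 hP
    obtain ⟨ha, hM⟩ := Set.union_subset_iff.1 haM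
    exact Set.union_subset ((A.values_refresh_subset _ _).trans hM)
      ((B.values_refresh_subset _ _).trans
        (hβ.values_subset.trans (Set.insert_subset (ha rfl) hN)))
  | send α p M M' q q' N N' β b ht hβ hα =>
    obtain ⟨hM, hN⟩ := Set.union_subset_iff.1 hP
    have hb := hβ.mem hB hN ht
    exact Set.union_subset
      ((A.values_refresh_subset _ _).trans (hα.values_subset.trans (Set.insert_subset hb hM)))
      ((B.values_refresh_subset _ _).trans (hβ.values_subset.trans (Set.insert_subset hb hN)))

/-- If Eloise has to answer `?a` for a constant `a`, then `a` occurs in `A`. -/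
def Pos.LetterIn (A : FVA K VA QA) : Pos K VA VB QA QB → Prop
  | .afterRecv α _ _ _ _ => ∀ a, α = .const a → a ∈ A.consts
  | _ => True

theorem AbelardMove.letterIn {D : Set K} {P P' : Pos K VA VB QA QB}
    (h : AbelardMove A D P P') : P'.LetterIn A := by
  cases h with
  | send => trivial
  | recv p p' M q N α ht =>
    rintro a rfl
    exact ⟨p, _, p', ht⟩

theorem EloiseMove.letterIn {D : Set K} {P P' : Pos K VA VB QA QB}
    (h : EloiseMove A B D P P') : P'.LetterIn A := by
  cases h <;> trivial

end Moves

/-! ### Histories and strategies -/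

section Strategies

variable {K VA VB QA QB : Type*} {A : FVA K VA QA} {B : FVA K VB QB}

theorem History.mono {D D' : Set K} (hD : D ⊆ D') {s : Strategy K VA VB QA QB}
    {h : List (Pos K VA VB QA QB)} (hh : History A B D s h) : History A B D' s h := by
  induction hh with
  | start => exact .start
  | abelard P P' h _ hm ih => exact .abelard P P' h ih (hm.mono hD)
  | eloise P h _ hm ih => exact .eloise P h ih (hm.mono hD)

theorem History.consts_subset {D : Set K} (hA : A.consts ⊆ D) (hB : B.consts ⊆ D)
    {s : Strategy K VA VB QA QB} {h : List (Pos K VA VB QA QB)} (hh : History A B D s h) :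
    ∀ P ∈ h.head?, P.consts ⊆ D := by
  induction hh with
  | start =>
    rintro _ ⟨⟩ a (⟨x, hx⟩ | ⟨x, hx⟩) <;> cases hx
  | abelard P P' h _ hm ih =>
    rintro _ ⟨⟩
    exact hm.consts_subset hA (ih P rfl)
  | eloise P h _ hm ih =>
    rintro _ ⟨⟩
    exact hm.consts_subset hB (ih P rfl)

/-- If Eloise can stay in a set `W` of positions that contains the starting position and that
Abelard cannot leave, then she has a strategy that always moves within `W`. -/
theorem exists_strategy_of_region (W : Set (Pos K VA VB QA QB)) (D : Pos K VA VB QA QB → Set K)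
    (h0 : startPos A B ∈ W) (hA : ∀ P ∈ W, ∀ P', AbelardMove A Set.univ P P' → P' ∈ W)
    (hE : ∀ P ∈ W, P.IsEloise → ∃ P' ∈ W, EloiseMove A B (D P) P P') :
    ∃ s : Strategy K VA VB QA QB, ∀ P h, History A B Set.univ s (P :: h) → P.IsEloise →
      EloiseMove A B (D P) P (s (P :: h)) := by
  choose f hfW hf using hE
  classical
  -- A positional strategy suffices. The value `P` outside `W` is junk, never reached because plays
  -- stay in `W`.
  let s : Strategy K VA VB QA QB := fun h =>
    match h with
    | [] => startPos A B
    | P :: _ => if hP : P ∈ W ∧ P.IsEloise then f P hP.1 hP.2 else P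
  have hs : ∀ P h (hP : P ∈ W) (hPE : P.IsEloise), s (P :: h) = f P hP hPE := fun P h hP hPE =>
    dif_pos ⟨hP, hPE⟩
  have key : ∀ h, History A B Set.univ s h → ∀ P ∈ h.head?, P ∈ W := by
    intro h hh
    induction hh with
    | start =>
      rintro _ ⟨⟩
      exact h0
    | abelard P P' h _ hm ih =>
      rintro _ ⟨⟩
      exact hA P (ih P rfl) _ hm
    | eloise P h _ hm ih =>
      rintro _ ⟨⟩
      rw [hs P h (ih P rfl) hm.isEloise]
      exact hfW _ _ _
  refine ⟨s, fun P h hh hPE => ?_⟩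
  have hP := key _ hh P rfl
  rw [hs P h hP hPE]
  exact hf _ _ _

end Strategies

/-! ### Fresh constants -/

section Fresh

variable {K V Q VA VB QA QB : Type*} {A : FVA K VA QA} {B : FVA K VB QB}

theorem FVA.finite_consts (A : FVA K V Q) : A.consts.Finite := by
  have h : ((Letter.const : K → Letter K V) '' A.consts).Finite := by
    refine (A.trans.finite_toSet.image fun t => t.2.2.1).subset ?_
    rintro _ ⟨a, ⟨p, d, p', ht⟩, rfl⟩
    exact ⟨_, ht, rfl⟩
  exact h.of_finite_image fun a _ b _ hab => Letter.const.inj hab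

theorem exists_isFreshFamily [Infinite K] [Finite VA] [Finite VB] (A : FVA K VA QA)
    (B : FVA K VB QB) : ∃ c : (VA × VB) ⊕ (VB × VA) → K, IsFreshFamily A B c := by
  have := (A.finite_consts.union B.finite_consts).infinite_compl.to_subtype
  let e : (VA × VB) ⊕ (VB × VA) ↪ ((A.consts ∪ B.consts)ᶜ : Set K) :=
    (Finite.equivFin _).toEmbedding.trans (Fin.valEmbedding.trans (Infinite.natEmbedding _))
  exact ⟨fun i => e i, Subtype.val_injective.comp e.injective, fun i => (e i).2⟩

theorem finite_constPool [Finite VA] [Finite VB] (A : FVA K VA QA) (B : FVA K VB QB)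
    (c : (VA × VB) ⊕ (VB × VA) → K) : (constPool A B c).Finite :=
  (A.finite_consts.union B.finite_consts).union (Set.finite_range c)

/-- If a variable of `A` is free, then the family has more members than there are values. -/
theorem exists_notMem_values [Finite VA] [Finite VB] [Nonempty VB]
    {c : (VA × VB) ⊕ (VB × VA) → K} (hc : Function.Injective c) {M : Store K VA}
    (N : Store K VB) {x : VA} (hx : M x = none) : ∃ i, c i ∉ M.values ∪ N.values := by
  by_contra! h
  have h' : ∀ i, ∃ z : VA ⊕ VB, Sum.elim M N z = some (c i) := by
    intro i
    rcases h i with ⟨z, hz⟩ | ⟨z, hz⟩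
    exacts [⟨.inl z, hz⟩, ⟨.inr z, hz⟩]
  choose g hg using h'
  have hinj : Function.Injective g := fun i j hij =>
    hc (Option.some.inj ((hg i).symm.trans (hij ▸ hg j)))
  -- The free variable `x` carries no value, which makes the count strict.
  have hnot : ¬ Function.Surjective g := fun hs => by
    obtain ⟨i, hi⟩ := hs (.inl x)
    have := hg i
    simp [hi, hx] at this
  have := Fintype.ofFinite VA
  have := Fintype.ofFinite VB
  have hlt := Fintype.card_lt_of_injective_not_surjective g hinj hnot
  have hA : 0 < Fintype.card VA := Fintype.card_pos_iff.2 ⟨x⟩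
  have hB : 0 < Fintype.card VB := Fintype.card_pos
  simp only [Fintype.card_sum, Fintype.card_prod] at hlt
  nlinarith [Nat.le_mul_of_pos_right (Fintype.card VA) hB,
    Nat.le_mul_of_pos_right (Fintype.card VB) hA]

/-- A constant that neither occurs in the automata nor is a value can be renamed to a member of the
fresh family while the constants of the automata and the values are kept. -/
theorem exists_rename_to_fresh [Finite VA] [Finite VB] [Nonempty VB]
    {c : (VA × VB) ⊕ (VB × VA) → K} (hc : IsFreshFamily A B c) {M : Store K VA} {N : Store K VB}
    {x : VA} (hx : M x = none) {b : K} (hb : b ∉ A.consts ∪ B.consts) (hbM : b ∉ M.values)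
    (hbN : b ∉ N.values) :
    ∃ σ : Equiv.Perm K, (∀ a ∈ A.consts ∪ B.consts, σ a = a) ∧ M.rename σ = M ∧ N.rename σ = N ∧
      σ b ∈ Set.range c := by
  classical
  obtain ⟨i, hi⟩ := exists_notMem_values hc.1 N hx
  have hσ : ∀ {S : Set K}, b ∉ S → c i ∉ S → ∀ a ∈ S, Equiv.swap b (c i) a = a :=
    fun hb hc a ha => Equiv.swap_apply_of_ne_of_ne (fun h => hb (h ▸ ha)) (fun h => hc (h ▸ ha))
  exact ⟨Equiv.swap b (c i), hσ hb (hc.2 i),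
    Store.rename_eq_self (hσ hbM fun h => hi (Or.inl h)),
    Store.rename_eq_self (hσ hbN fun h => hi (Or.inr h)), by simp⟩

/-- Up to a renaming that keeps the constants of the automata, Eloise's moves instantiate variables
only by constants in the pool or present in the position. -/
theorem EloiseMove.exists_rename [Finite VA] [Finite VB] {c : (VA × VB) ⊕ (VB × VA) → K}
    (hc : IsFreshFamily A B c) {P P' : Pos K VA VB QA QB} (hP : P.LetterIn A)
    (h : EloiseMove A B Set.univ P P') :
    ∃ σ : Equiv.Perm K, (∀ a ∈ A.consts ∪ B.consts, σ a = a) ∧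
      EloiseMove A B (constPool A B c ∪ P.consts) P (P'.rename σ) := by
  cases h with
  | recv a p M q q' N N' β ht hβ =>
    -- In answering `!a` the constant is forced, so there is no choice to correct.
    refine ⟨1, fun _ _ => rfl, ?_⟩
    rw [Pos.rename_one]
    exact .recv _ _ _ _ _ _ _ β ht hβ
  | send α p M M' q q' N N' β b ht hβ hα =>
    by_cases hb : b ∈ constPool A B c ∪ (M.values ∪ N.values)
    · refine ⟨1, fun _ _ => rfl, ?_⟩
      rw [Pos.rename_one]
      exact .send _ _ _ _ _ _ _ _ β b ht (hβ.of_mem hb) hα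
    · simp only [constPool, Set.mem_union, not_or] at hb
      obtain ⟨⟨⟨hbA, hbB⟩, -⟩, hbM, hbN⟩ := hb
      -- As `b` neither occurs in the automata nor is a value, both the receiving and the sending
      -- letter must be free variables.
      obtain ⟨x, hx⟩ := hα.exists_free (fun h => hbA (hP b h)) hbM
      obtain ⟨y, -⟩ := hβ.exists_free
        (fun h => hbB ⟨q, Polarity.send, q', h ▸ ht⟩) hbN
      have : Nonempty VB := ⟨y⟩
      obtain ⟨σ, hσ, hσM, hσN, hσb⟩ := exists_rename_to_fresh hc hx (not_or.2 ⟨hbA, hbB⟩) hbM hbN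
      refine ⟨σ, hσ, ?_⟩
      have hα' := hα.rename σ
      have hβ' := (hβ.rename σ).of_mem (D' := constPool A B c ∪ (M.values ∪ N.values))
        (Or.inl (Or.inr hσb))
      rw [hσN, FVA.rename_letter (fun a ha => hσ a (Or.inr ha)) ht] at hβ'
      have hαl : α.rename σ = α := by
        cases α with
        | const a => exact congrArg Letter.const (hσ a (Or.inl (hP a rfl)))
        | var x => rfl
      rw [hσM, hαl] at hα'
      simp only [Pos.rename, FVA.rename_refresh]
      exact .send _ _ _ _ _ _ _ _ β _ ht hβ' hα'

/-- Up to a renaming that keeps the constants of the automata, Abelard's moves from a position all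
of whose constants are in the pool instantiate variables only by constants in the pool. -/
theorem AbelardMove.exists_rename [Finite VA] [Finite VB] {c : (VA × VB) ⊕ (VB × VA) → K}
    (hc : IsFreshFamily A B c) (hV : Nonempty VB ∨ IsEmpty VA) {P P' : Pos K VA VB QA QB}
    (hP : P.consts ⊆ constPool A B c) (h : AbelardMove A Set.univ P P') :
    ∃ σ : Equiv.Perm K, (∀ a ∈ A.consts ∪ B.consts, σ a = a) ∧
      AbelardMove A (constPool A B c) P (P'.rename σ) := by
  cases h with
  | recv p p' M q N α ht =>
    refine ⟨1, fun _ _ => rfl, ?_⟩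
    rw [Pos.rename_one]
    exact .recv _ _ _ _ _ _ ht
  | send p p' M M' q N α a ht hα =>
    by_cases ha : a ∈ constPool A B c
    · refine ⟨1, fun _ _ => rfl, ?_⟩
      rw [Pos.rename_one]
      exact .send _ _ _ _ _ _ _ _ ht (hα.of_mem ha)
    · have haS : a ∉ A.consts ∪ B.consts := fun h => ha (Or.inl h)
      have haM : a ∉ M.values := fun h => ha (hP (Or.inl h))
      have haN : a ∉ N.values := fun h => ha (hP (Or.inr h))
      obtain ⟨x, hx⟩ := hα.exists_free
        (fun h => haS (Or.inl ⟨p, Polarity.send, p', h ▸ ht⟩)) haM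
      -- Abelard has just instantiated a variable, so `VA` is not empty.
      have : Nonempty VB := hV.resolve_right fun h => h.elim x
      obtain ⟨σ, hσ, hσM, hσN, hσa⟩ := exists_rename_to_fresh hc hx haS haM haN
      refine ⟨σ, hσ, ?_⟩
      have hα' := (hα.rename σ).of_mem (D' := constPool A B c) (Or.inr hσa)
      rw [hσM, FVA.rename_letter (fun a ha => hσ a (Or.inl ha)) ht] at hα'
      simp only [Pos.rename, hσN]
      exact .send _ _ _ _ _ _ _ _ ht hα'

end Fresh

/-! ### Transfer of winning strategies -/

section Transfer

variable {K VA VB QA QB : Type*} {A : FVA K VA QA} {B : FVA K VB QB}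

theorem inv_apply_of_fixed {S : Set K} {τ : Equiv.Perm K} (hτ : ∀ a ∈ S, τ a = a) :
    ∀ a ∈ S, τ⁻¹ a = a := fun a ha => Equiv.Perm.inv_eq_iff_eq.2 (hτ a ha).symm

theorem InstantiatesFrom.isWinning_univ {C : Set K} {s : Strategy K VA VB QA QB}
    (h : InstantiatesFrom A B C s) : IsWinning A B Set.univ s :=
  fun P l hl hP => (h P l hl hP).mono (Set.subset_univ _)

/-- While Abelard also stays in `C`, every constant present lies in `C`, so the allowance for
present constants adds nothing. -/
theorem InstantiatesFrom.isWinning {C : Set K} (hA : A.consts ⊆ C) (hB : B.consts ⊆ C)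
    {s : Strategy K VA VB QA QB} (h : InstantiatesFrom A B C s) : IsWinning A B C s :=
  fun P l hl hP => (h P l (hl.mono (Set.subset_univ _)) hP).mono
    (Set.union_subset subset_rfl (hl.consts_subset hA hB P rfl))

/-- The region consists of the positions that some admissible permutation carries to a position
reached under `s`. Abelard's moves keep the permutation; Eloise pulls back the answer of `s` and
corrects it into the pool. -/
theorem exists_instantiatesFrom [Finite VA] [Finite VB] {c : (VA × VB) ⊕ (VB × VA) → K}
    (hc : IsFreshFamily A B c) {s : Strategy K VA VB QA QB} (hs : IsWinning A B Set.univ s) :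
    ∃ s', InstantiatesFrom A B (constPool A B c) s' := by
  refine exists_strategy_of_region
    {P | P.LetterIn A ∧ ∃ τ : Equiv.Perm K, (∀ a ∈ A.consts ∪ B.consts, τ a = a) ∧
      ∃ h, History A B Set.univ s (P.rename τ :: h)} _ ?_ ?_ ?_
  · exact ⟨trivial, 1, fun _ _ => rfl, [], .start⟩
  · rintro P ⟨-, τ, hτ, h, hh⟩ P' hm
    exact ⟨hm.letterIn, τ, hτ, _, .abelard _ _ _ hh (hm.rename fun a ha => hτ a (Or.inl ha))⟩
  · rintro P ⟨hP, τ, hτ, h, hh⟩ hPE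
    have hm := hs _ _ hh ((Pos.isEloise_rename τ P).2 hPE)
    have hm' := hm.rename (τ := τ⁻¹) fun a ha => inv_apply_of_fixed hτ a (Or.inr ha)
    rw [← Pos.rename_mul, inv_mul_cancel, Pos.rename_one] at hm'
    obtain ⟨σ, hσ, hmσ⟩ := hm'.exists_rename hc hP
    -- The new position is the answer of `s` renamed by `τ⁻¹` and then by `σ`; `τ * σ⁻¹` undoes
    -- both.
    refine ⟨_, ⟨hmσ.letterIn, τ * σ⁻¹, fun a ha => ?_, P.rename τ :: h, ?_⟩, hmσ⟩
    · rw [Equiv.Perm.mul_apply, inv_apply_of_fixed hσ a ha, hτ a ha]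
    · rw [← Pos.rename_mul, ← Pos.rename_mul]
      simp only [inv_mul_cancel_right, mul_inv_cancel, Pos.rename_one]
      exact .eloise _ _ hh hm

/-- Here it is Abelard's choice that is corrected: his move, carried over to the restricted play, is
renamed into the pool. Eloise's answer is pulled back unchanged. -/
theorem exists_isWinning_univ [Finite VA] [Finite VB] {c : (VA × VB) ⊕ (VB × VA) → K}
    (hc : IsFreshFamily A B c) (hV : Nonempty VB ∨ IsEmpty VA) {s : Strategy K VA VB QA QB}
    (hs : IsWinning A B (constPool A B c) s) : ∃ s', IsWinning A B Set.univ s' := by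
  have hA : A.consts ⊆ constPool A B c := fun a ha => Or.inl (Or.inl ha)
  have hB : B.consts ⊆ constPool A B c := fun a ha => Or.inl (Or.inr ha)
  refine exists_strategy_of_region
    {P | ∃ τ : Equiv.Perm K, (∀ a ∈ A.consts ∪ B.consts, τ a = a) ∧
      ∃ h, History A B (constPool A B c) s (P.rename τ :: h)} _ ?_ ?_ ?_
  · exact ⟨1, fun _ _ => rfl, [], .start⟩
  · rintro P ⟨τ, hτ, h, hh⟩ P' hm
    obtain ⟨σ, hσ, hmσ⟩ := (hm.rename fun a ha => hτ a (Or.inl ha)).exists_rename hc hV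
      (hh.consts_subset hA hB _ rfl)
    refine ⟨σ * τ, fun a ha => ?_, P.rename τ :: h, ?_⟩
    · rw [Equiv.Perm.mul_apply, hτ a ha, hσ a ha]
    · rw [Pos.rename_mul]
      exact .abelard _ _ _ hh hmσ
  · rintro P ⟨τ, hτ, h, hh⟩ hPE
    have hm := hs _ _ hh ((Pos.isEloise_rename τ P).2 hPE)
    have hm' := (hm.mono (Set.subset_univ _)).rename (τ := τ⁻¹)
      fun a ha => inv_apply_of_fixed hτ a (Or.inr ha)
    rw [← Pos.rename_mul, inv_mul_cancel, Pos.rename_one] at hm'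
    refine ⟨_, ⟨τ, hτ, P.rename τ :: h, ?_⟩, hm'⟩
    rw [← Pos.rename_mul, mul_inv_cancel, Pos.rename_one]
    exact .eloise _ _ hh hm

end Transfer

theorem mainTheorem1 {K VA VB QA QB : Type*} [Countable K] [Infinite K]
    [Finite VA] [Finite VB] [Finite QA] [Finite QB]
    (A : FVA K VA QA) (B : FVA K VB QB) :
    (∃ c : (VA × VB) ⊕ (VB × VA) → K, IsFreshFamily A B c) ∧
    ∀ c : (VA × VB) ⊕ (VB × VA) → K, IsFreshFamily A B c →
      (constPool A B c).Finite ∧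
      ((∃ s, IsWinning A B Set.univ s) ↔
        ∃ s, IsWinning A B Set.univ s ∧ InstantiatesFrom A B (constPool A B c) s ∧
          IsWinning A B (constPool A B c) s) ∧
      (Nonempty VB ∨ IsEmpty VA →
        ((∃ s, IsWinning A B Set.univ s) ↔ ∃ s, IsWinning A B (constPool A B c) s)) := by
  refine ⟨exists_isFreshFamily A B, fun c hc => ?_⟩
  have hA : A.consts ⊆ constPool A B c := fun a ha => Or.inl (Or.inl ha)
  have hB : B.consts ⊆ constPool A B c := fun a ha => Or.inl (Or.inr ha)
  refine ⟨finite_constPool A B c, ⟨?_, fun ⟨s, hs, _⟩ => ⟨s, hs⟩⟩, fun hV => ⟨?_, ?_⟩⟩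
  · rintro ⟨s, hs⟩
    obtain ⟨s', hs'⟩ := exists_instantiatesFrom hc hs
    exact ⟨s', hs'.isWinning_univ, hs', hs'.isWinning hA hB⟩
  · rintro ⟨s, hs⟩
    obtain ⟨s', hs'⟩ := exists_instantiatesFrom hc hs
    exact ⟨s', hs'.isWinning hA hB⟩
  · rintro ⟨s, hs⟩
    exact exists_isWinning_univ hc hV hs
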